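/- Let $n\ge 1$, let $\gamma(t)=(t,t^2,\dots,t^{n+1})$ and $\bar\gamma(t)=(t,\dots,t^n)$ for $t\in[0,1]$. For $k\ge 0$ put $\Delta_c^k=\{r\in\mathbb R^k: r_j\ge 0,\ \sum_j r_j\le 1\}$ and $\Delta_*^k=\{y\in\mathbb R^k: 0\le y_1\le\dots\le y_k\le 1\}$. If $n=2\ell$, define on $\Delta_c^\ell\times\Delta_*^\ell$ $$U_n(\lambda,y)=\sum_{j=1}^{\ell}\lambda_j\gamma(y_j)+\Big(1-\sum_{j=1}^{\ell}\lambda_j\Big)\gamma(1),\qquad L_n(\lambda,y)=\Big(1-\sum_{j=1}^{\ell}\lambda_j\Big)\gamma(0)+\sum_{j=1}^{\ell}\lambda_j\gamma(y_j).$$ If $n=2\ell-1$, define, on $\Delta_c^{\ell}\times\Delta_*^{\ell-1}$ and $\Delta_c^{\ell-1}\times\Delta_*^{\ell}$ respectively, $$U_n(\beta_1,\dots,\beta_\ell,y_2,\dots,y_\ell)=\Big(1-\sum_{j=1}^{\ell}\beta_j\Big)\gamma(0)+\sum_{j=2}^{\ell}\beta_j\gamma(y_j)+\beta_1\gamma(1),$$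 $$L_n(\beta_2,\dots,\beta_\ell,y_1,\dots,y_\ell)=\Big(1-\sum_{j=2}^{\ell}\beta_j\Big)\gamma(y_1)+\sum_{j=2}^{\ell}\beta_j\gamma(y_j).$$ For $x\in\mathbb R^n$ let $B^{\sup}(x)$ (respectively $B^{\inf}(x)$) denote the number $z$ such that $(x,z)$ lies in the image of $U_n$ (respectively $L_n$), whenever there is exactly one such $z$. With $x_0:=1$, define for points $(x_1,\dots,x_N)$ $$S_{2k}=\det(x_{i+j})_{0\le i,j\le k},\qquad S_{2k+1}=\det(x_{i+j+1})_{0\le i,j\le k},$$ $$K_{2k}=\det(x_{i+j+1}-x_{i+j+2})_{0\le i,j\le k-1},\qquad K_{2k+1}=\det(x_{i+j}-x_{i+j+1})_{0\le i,j\le k}.$$ Let $x=(x_1,\dots,x_n)$ be in the interior of $\mathrm{conv}(\bar\gamma([0,1]))\subset\mathbb R^n$. Then $B^{\sup}(x)$ and $B^{\inf}(x)$ are well defined (there is exactly one such $z$ in each case), $B^{\sup}(x)$ is the unique real solution $x_{n+1}$ of $K_{n+1}(x_1,\dots,x_n,x_{n+1})=0$, and $B^{\inf}(x)$ is the unique real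 solution $x_{n+1}$ of $S_{n+1}(x_1,\dots,x_n,x_{n+1})=0$. -/

import Mathlib

open Set

noncomputable section

namespace CurveHull

/-- `Δ_c^k`: nonnegative weights of total mass at most `1`. -/
def weightSimplex (k : ℕ) : Set (Fin k → ℝ) :=
  {r | (∀ j, 0 ≤ r j) ∧ ∑ j, r j ≤ 1}

/-- `Δ_*^k`: ordered nodes `a ≤ y₁ ≤ … ≤ y_k ≤ b`. -/
def nodeSimplex (a b : ℝ) (k : ℕ) : Set (Fin k → ℝ) :=
  {y | (∀ j, y j ∈ Icc a b) ∧ Monotone y}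

section Maps

variable {d : ℕ} (γ : ℝ → Fin d → ℝ) (a b : ℝ)

/-- `U_n` for `n = 2ℓ`. -/
def UEven (ℓ : ℕ) (p : (Fin ℓ → ℝ) × (Fin ℓ → ℝ)) : Fin d → ℝ :=
  ∑ j, p.1 j • γ (p.2 j) + (1 - ∑ j, p.1 j) • γ b

/-- `L_n` for `n = 2ℓ`. -/
def LEven (ℓ : ℕ) (p : (Fin ℓ → ℝ) × (Fin ℓ → ℝ)) : Fin d → ℝ :=
  (1 - ∑ j, p.1 j) • γ a + ∑ j, p.1 j • γ (p.2 j)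

/-- `U_n` for `n = 2ℓ - 1`, with `ℓ = m + 1`. The weights `β₁, …, β_ℓ` are `p.1 0, …, p.1 m`
and the nodes `x₂, …, x_ℓ` are `p.2 0, …, p.2 (m - 1)`. -/
def UOdd (m : ℕ) (p : (Fin (m + 1) → ℝ) × (Fin m → ℝ)) : Fin d → ℝ :=
  (1 - ∑ j, p.1 j) • γ a + ∑ j : Fin m, p.1 j.succ • γ (p.2 j) + p.1 0 • γ b

/-- `L_n` for `n = 2ℓ - 1`, with `ℓ = m + 1`. The weights `β₂, …, β_ℓ` are
`p.1 0, …, p.1 (m - 1)` and the nodes `x₁, …, x_ℓ` are `p.2 0, …, p.2 m`. -/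
def LOdd (m : ℕ) (p : (Fin m → ℝ) × (Fin (m + 1) → ℝ)) : Fin d → ℝ :=
  (1 - ∑ j, p.1 j) • γ (p.2 0) + ∑ j : Fin m, p.1 j • γ (p.2 j.succ)

end Maps

section Hulls

variable {n : ℕ} (γ : ℝ → Fin (n + 1) → ℝ) (a b : ℝ)

/-- The image of `U_n` (if `n` is odd, then `n / 2 = ℓ - 1` where `n = 2ℓ - 1`). -/
def upperSurface : Set (Fin (n + 1) → ℝ) :=
  if Even n then UEven γ b (n / 2) '' (weightSimplex (n / 2) ×ˢ nodeSimplex a b (n / 2))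
  else UOdd γ a b (n / 2) '' (weightSimplex (n / 2 + 1) ×ˢ nodeSimplex a b (n / 2))

/-- The image of `L_n`. -/
def lowerSurface : Set (Fin (n + 1) → ℝ) :=
  if Even n then LEven γ a (n / 2) '' (weightSimplex (n / 2) ×ˢ nodeSimplex a b (n / 2))
  else LOdd γ (n / 2) '' (weightSimplex (n / 2) ×ˢ nodeSimplex a b (n / 2 + 1))

/-- `B^sup`, determined by `B^sup (Ū_n) = U_n^z`: a value `z` such that `(x, z)` is in the image
of `U_n`. That there is exactly one such `z` has to be proved. -/
def Bsup (x : Fin n → ℝ) : ℝ :=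
  Classical.epsilon fun z : ℝ => (Fin.snoc x z : Fin (n + 1) → ℝ) ∈ upperSurface γ a b

/-- `B^inf`, determined by `B^inf (L̄_n) = L_n^z`: a value `z` such that `(x, z)` is in the image
of `L_n`. That there is exactly one such `z` has to be proved. -/
def Binf (x : Fin n → ℝ) : ℝ :=
  Classical.epsilon fun z : ℝ => (Fin.snoc x z : Fin (n + 1) → ℝ) ∈ lowerSurface γ a b

/-- The curve `γ̄ = (γ₁, …, γ_n)`. -/
def projCurve (t : ℝ) : Fin n → ℝ := fun i => γ t i.castSucc

end Hulls

/-- The moment curve `(t, t², …, t^d)`. -/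
def momentCurve (d : ℕ) (t : ℝ) : Fin d → ℝ := fun i => t ^ (i.val + 1)

/-- The sequence `x₀ = 1, x₁, …, x_d` of a point `(x₁, …, x_d)`, continued by `0`
(the determinants below only use `x₀, …, x_d`). -/
def moment {d : ℕ} (v : Fin d → ℝ) : ℕ → ℝ
  | 0 => 1
  | k + 1 => if h : k < d then v ⟨k, h⟩ else 0

/-- `S_N` at the point `(x₁, …, x_N)`: for `N = 2k` the determinant of `(x_{i+j})`, `0 ≤ i, j ≤ k`,
and for `N = 2k + 1` that of `(x_{i+j+1})`, `0 ≤ i, j ≤ k`. -/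
def hankelS (N : ℕ) (v : Fin N → ℝ) : ℝ :=
  if Even N then
    (Matrix.of fun i j : Fin (N / 2 + 1) => moment v (i.val + j.val)).det
  else
    (Matrix.of fun i j : Fin (N / 2 + 1) => moment v (i.val + j.val + 1)).det

/-- `K_N` at the point `(x₁, …, x_N)`: for `N = 2k` the determinant of `(x_{i+j+1} - x_{i+j+2})`,
`0 ≤ i, j ≤ k - 1`, and for `N = 2k + 1` that of `(x_{i+j} - x_{i+j+1})`, `0 ≤ i, j ≤ k`. -/
def hankelK (N : ℕ) (v : Fin N → ℝ) : ℝ :=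
  if Even N then
    (Matrix.of fun i j : Fin (N / 2) =>
      moment v (i.val + j.val + 1) - moment v (i.val + j.val + 2)).det
  else
    (Matrix.of fun i j : Fin (N / 2 + 1) =>
      moment v (i.val + j.val) - moment v (i.val + j.val + 1)).det

end CurveHull

end

namespace CurveHull

open Polynomial

/-! A point `v` acts on polynomials by `L_v (X ^ k) = moment v k`. Each determinant in question is
the Gram determinant of `(Q, R) ↦ L_v (w * Q * R)` on degrees at most `s`, with `w.natDegree + 2 * s
= n + 1`. For `K` the weight `w` is `1 - X` (`n` even) or `X * (1 - X)` (`n` odd), and for `S` it is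
`X` or `1`. The roots of `w` are exactly the fixed end points in the corresponding surface.

At most one zero: above an interior `x`, a kernel polynomial `Q` has degree exactly `s`, since
otherwise `w * Q ^ 2` has degree at most `n` and a positive moment at `x`. Kernel polynomials `Q`,
`Q'` for `z`, `z'` give a polynomial `w * Q * Q'` of degree `n + 1` annihilated at both points. Its
moment is affine in the last coordinate with nonzero slope, so `z = z'`
(`eq_of_det_weightedHankel_eq_zero`). On a surface the determinant vanishes, with the product of the
`X - y_j` in the kernel.

Existence: a supporting hyperplane at the top or bottom of the fibre over `x` is a polynomial `p ≥
0` on `[0, 1]` of degree `n + 1` with moment zero (`exists_supporting_polynomial`). The point is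
then a convex combination of curve points at roots of `p`. Interior roots are double, and the
leading sign controls the root at `1`. A parity count yields the number of nodes the surface allows
(`exists_ordered_representation`). -/

/-! ### The moment functional and its positivity -/

/-- The linear functional on polynomials sending `X ^ k` to the `k`-th entry of the moment
sequence of `v`. -/
noncomputable def momentFunctional {d : ℕ} (v : Fin d → ℝ) : ℝ[X] →ₗ[ℝ] ℝ :=
  Polynomial.lsum fun k => moment v k • LinearMap.id

lemma momentFunctional_X_pow {d : ℕ} (v : Fin d → ℝ) (k : ℕ) :
    momentFunctional v (X ^ k) = moment v k := by
  rw [momentFunctional, Polynomial.lsum_apply, ← monomial_one_right_eq_X_pow,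
    sum_monomial_index] <;> simp

/-- On polynomials of degree at most `d`, the moment functional is affine in the point. -/
lemma momentFunctional_apply {d : ℕ} (v : Fin d → ℝ) {p : ℝ[X]} (hp : p.natDegree ≤ d) :
    momentFunctional v p = p.coeff 0 + ∑ i : Fin d, p.coeff (i + 1) * v i := by
  rw [momentFunctional, Polynomial.lsum_apply,
    sum_over_range' _ (by simp) (d + 1) (by omega), Finset.sum_range_succ', Finset.sum_range,
    add_comm]
  congr 1
  · simp [moment]
  · refine Finset.sum_congr rfl fun i _ => ?_
    simp [moment, mul_comm]

/-- The linear part of `momentFunctional v p` as a function of `v`. -/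
noncomputable def coeffForm (d : ℕ) (p : ℝ[X]) : (Fin d → ℝ) →ₗ[ℝ] ℝ :=
  ∑ i : Fin d, p.coeff (i + 1) • LinearMap.proj i

lemma coeffForm_apply {d : ℕ} (p : ℝ[X]) (v : Fin d → ℝ) :
    coeffForm d p v = ∑ i : Fin d, p.coeff (i + 1) * v i := by
  simp [coeffForm]

lemma momentFunctional_eq_coeffForm {d : ℕ} (v : Fin d → ℝ) {p : ℝ[X]} (hp : p.natDegree ≤ d) :
    momentFunctional v p = p.coeff 0 + coeffForm d p v := by
  rw [momentFunctional_apply v hp, coeffForm_apply]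

lemma coeffForm_momentCurve {d : ℕ} (t : ℝ) {p : ℝ[X]} (hp : p.natDegree ≤ d) :
    coeffForm d p (momentCurve d t) = p.eval t - p.coeff 0 := by
  rw [coeffForm_apply, eval_eq_sum_range' (Nat.lt_succ_of_le hp), Finset.sum_range_succ',
    Finset.sum_range]
  simp [momentCurve]

lemma momentFunctional_sum {d : ℕ} {ι : Type*} (s : Finset ι) (c τ : ι → ℝ)
    (hc : ∑ i ∈ s, c i = 1) {p : ℝ[X]} (hp : p.natDegree ≤ d) :
    momentFunctional (∑ i ∈ s, c i • momentCurve d (τ i)) p = ∑ i ∈ s, c i * p.eval (τ i) := by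
  rw [momentFunctional_eq_coeffForm _ hp, map_sum]
  simp only [map_smul, coeffForm_momentCurve _ hp, smul_eq_mul, mul_sub, Finset.sum_sub_distrib,
    ← Finset.sum_mul, hc]
  ring

lemma momentFunctional_snoc {n : ℕ} (x : Fin n → ℝ) (z : ℝ) {p : ℝ[X]}
    (hp : p.natDegree ≤ n + 1) :
    momentFunctional (Fin.snoc x z : Fin (n + 1) → ℝ) p =
      p.coeff 0 + coeffForm n p x + p.coeff (n + 1) * z := by
  rw [momentFunctional_apply _ hp, Fin.sum_univ_castSucc, coeffForm_apply]
  simp [add_assoc]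

lemma momentFunctional_snoc_of_natDegree_le {n : ℕ} (x : Fin n → ℝ) (z : ℝ) {p : ℝ[X]}
    (hp : p.natDegree ≤ n) :
    momentFunctional (Fin.snoc x z : Fin (n + 1) → ℝ) p = momentFunctional x p := by
  rw [momentFunctional_snoc x z (by omega), momentFunctional_eq_coeffForm x hp,
    coeff_eq_zero_of_natDegree_lt (Nat.lt_succ_of_le hp)]
  simp

/-- The condition is a closed half-space in `v`, and on the curve it reads `0 ≤ p.eval t`. -/
lemma momentFunctional_nonneg_of_mem_convexHull {d : ℕ} {p : ℝ[X]} (hp : p.natDegree ≤ d)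
    (hnn : ∀ t ∈ Icc (0 : ℝ) 1, 0 ≤ p.eval t) {v : Fin d → ℝ}
    (hv : v ∈ convexHull ℝ (momentCurve d '' Icc 0 1)) : 0 ≤ momentFunctional v p := by
  have hsub : convexHull ℝ (momentCurve d '' Icc 0 1) ⊆ {v | -p.coeff 0 ≤ coeffForm d p v} := by
    refine convexHull_min ?_ (convex_halfSpace_ge (coeffForm d p).isLinear _)
    rintro _ ⟨t, ht, rfl⟩
    have := hnn t ht
    simp only [mem_ofPred_eq, coeffForm_momentCurve t hp]
    linarith
  have := hsub hv
  rw [momentFunctional_eq_coeffForm v hp]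
  simp only [mem_ofPred_eq] at this
  linarith

/-- A nonzero polynomial that is nonnegative on `[0, 1]` has a positive moment at every interior
point of the moment space. -/
lemma momentFunctional_pos_of_mem_interior {d : ℕ} {p : ℝ[X]} (hp : p.natDegree ≤ d)
    (hnn : ∀ t ∈ Icc (0 : ℝ) 1, 0 ≤ p.eval t) (hp0 : p ≠ 0) {x : Fin d → ℝ}
    (hx : x ∈ interior (convexHull ℝ (momentCurve d '' Icc 0 1))) :
    0 < momentFunctional x p := by
  refine lt_of_le_of_ne
    (momentFunctional_nonneg_of_mem_convexHull hp hnn (interior_subset hx)) fun h0 => hp0 ?_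
  have hform : ∀ u, coeffForm d p u = 0 := by
    intro u
    have hcont : ContinuousAt (fun s : ℝ => x + s • u) 0 := by fun_prop
    -- Along any line through `x` the functional is affine, nonnegative near `x` and zero at `x`, so
    -- its slope vanishes.
    have hloc : IsLocalMin (fun s : ℝ => coeffForm d p x + s * coeffForm d p u) 0 := by
      have := hcont.preimage_mem_nhds (t := convexHull ℝ (momentCurve d '' Icc 0 1))
        (by simpa using mem_interior_iff_mem_nhds.1 hx)
      filter_upwards [this] with s hs
      have h1 := momentFunctional_nonneg_of_mem_convexHull hp hnn hs
      rw [h0, momentFunctional_eq_coeffForm x hp, momentFunctional_eq_coeffForm _ hp, map_add,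
        map_smul, smul_eq_mul] at h1
      linarith
    have hder : HasDerivAt (fun s : ℝ => coeffForm d p x + s * coeffForm d p u)
        (coeffForm d p u) 0 := by
      simpa using ((hasDerivAt_id (0 : ℝ)).mul_const (coeffForm d p u)).const_add
        (coeffForm d p x)
    exact hloc.hasDerivAt_eq_zero hder
  have hc0 : p.coeff 0 = 0 := by
    rw [momentFunctional_eq_coeffForm x hp, hform] at h0
    linarith
  ext k
  rcases k with _ | k
  · simpa using hc0
  · by_cases hk : k < d
    · have := hform (Pi.single ⟨k, hk⟩ 1)
      rw [coeffForm_apply] at this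
      simpa [Pi.single_apply] using this
    · rw [coeff_eq_zero_of_natDegree_lt (by omega), coeff_zero]

/-! ### Weighted Hankel determinants and their zeros -/

/-- The Hankel matrix of the functional `p ↦ L (w * p)`, where `L` is the moment functional
of `v`. -/
noncomputable def weightedHankel {d : ℕ} (v : Fin d → ℝ) (w : ℝ[X]) (s : ℕ) :
    Matrix (Fin (s + 1)) (Fin (s + 1)) ℝ :=
  Matrix.of fun i j => momentFunctional v (w * X ^ (i.val + j.val))

/-- A kernel vector is the coefficient vector of `Q`, and the rows test against the monomials `R = X
^ i`. -/
lemma det_weightedHankel_eq_zero_iff {d : ℕ} (v : Fin d → ℝ) (w : ℝ[X]) (s : ℕ) :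
    (weightedHankel v w s).det = 0 ↔ ∃ Q : ℝ[X], Q ≠ 0 ∧ Q.natDegree ≤ s ∧
      ∀ R : ℝ[X], R.natDegree ≤ s → momentFunctional v (w * Q * R) = 0 := by
  have hmul : ∀ (Q : ℝ[X]), Q.natDegree ≤ s → ∀ i : Fin (s + 1),
      (weightedHankel v w s).mulVec (fun j => Q.coeff j) i =
        momentFunctional v (w * Q * X ^ i.val) := by
    intro Q hQ i
    conv_rhs => rw [Q.as_sum_range_C_mul_X_pow' (Nat.lt_succ_of_le hQ), Finset.mul_sum,
      Finset.sum_mul, map_sum, Finset.sum_range]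
    rw [Matrix.mulVec, dotProduct]
    refine Finset.sum_congr rfl fun j _ => ?_
    have : w * (C (Q.coeff j) * X ^ j.val) * X ^ i.val =
        Q.coeff j • (w * X ^ (i.val + j.val)) := by
      rw [smul_eq_C_mul]; ring
    rw [this, map_smul, smul_eq_mul, mul_comm]
    rfl
  rw [← Matrix.exists_mulVec_eq_zero_iff]
  constructor
  · rintro ⟨q, hq0, hq⟩
    set Q : ℝ[X] := ∑ i : Fin (s + 1), C (q i) * X ^ i.val with hQ
    have hcoeff : ∀ j : Fin (s + 1), Q.coeff j = q j := by
      intro j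
      simp [hQ, coeff_X_pow, Fin.val_inj]
    have hdeg : Q.natDegree ≤ s := by
      refine natDegree_sum_le_of_forall_le _ _ fun i _ => ?_
      exact (natDegree_C_mul_X_pow_le _ _).trans (by omega)
    refine ⟨Q, ?_, hdeg, fun R hR => ?_⟩
    · rintro h
      apply hq0
      ext j
      rw [← hcoeff, h]
      simp
    · rw [R.as_sum_range_C_mul_X_pow' (Nat.lt_succ_of_le hR), Finset.mul_sum, map_sum]
      refine Finset.sum_eq_zero fun i hi => ?_
      have h1 := hmul Q hdeg ⟨i, Finset.mem_range.1 hi⟩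
      simp only [hcoeff, hq, Pi.zero_apply] at h1
      have : w * Q * (C (R.coeff i) * X ^ i) = R.coeff i • (w * Q * X ^ i) := by
        rw [smul_eq_C_mul]; ring
      rw [this, map_smul, ← h1, smul_zero]
  · rintro ⟨Q, hQ0, hdeg, hQ⟩
    refine ⟨fun j => Q.coeff j, fun h => hQ0 ?_, ?_⟩
    · ext k
      by_cases hk : k < s + 1
      · simpa using congrFun h ⟨k, hk⟩
      · rw [coeff_eq_zero_of_natDegree_lt (by omega), coeff_zero]
    · ext i
      rw [hmul Q hdeg i]
      exact hQ _ (by simpa using (by omega : i.val ≤ s))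

/-- Above an interior point of the moment space, a weighted Hankel determinant whose weight is
nonnegative on `[0, 1]` vanishes at most once. -/
lemma eq_of_det_weightedHankel_eq_zero {n s : ℕ} {w : ℝ[X]} (hw0 : w ≠ 0)
    (hw : ∀ t ∈ Icc (0 : ℝ) 1, 0 ≤ w.eval t) (hs : w.natDegree + 2 * s = n + 1)
    {x : Fin n → ℝ} (hx : x ∈ interior (convexHull ℝ (momentCurve n '' Icc 0 1))) {z z' : ℝ}
    (hz : (weightedHankel (Fin.snoc x z : Fin (n + 1) → ℝ) w s).det = 0)
    (hz' : (weightedHankel (Fin.snoc x z' : Fin (n + 1) → ℝ) w s).det = 0) : z = z' := by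
  -- If `Q` had smaller degree, `w * Q * Q` would have degree at most `n`. Its moment would then
  -- depend on `x` alone and be positive, against the choice `R = Q`.
  have key : ∀ (z : ℝ) (Q : ℝ[X]), Q ≠ 0 → Q.natDegree ≤ s → (∀ R : ℝ[X], R.natDegree ≤ s →
      momentFunctional (Fin.snoc x z : Fin (n + 1) → ℝ) (w * Q * R) = 0) → Q.natDegree = s := by
    intro z Q hQ0 hdeg hQ
    by_contra hne
    have hd : (w * Q * Q).natDegree ≤ n := by
      rw [natDegree_mul (mul_ne_zero hw0 hQ0) hQ0, natDegree_mul hw0 hQ0]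
      omega
    have h1 := hQ Q hdeg
    rw [momentFunctional_snoc_of_natDegree_le x z hd] at h1
    refine (momentFunctional_pos_of_mem_interior hd (fun t ht => ?_)
      (mul_ne_zero (mul_ne_zero hw0 hQ0) hQ0) hx).ne' h1
    rw [eval_mul, eval_mul, mul_assoc]
    exact mul_nonneg (hw t ht) (mul_self_nonneg _)
  obtain ⟨Q, hQ0, hQd, hQ⟩ := (det_weightedHankel_eq_zero_iff _ w s).1 hz
  obtain ⟨Q', hQ0', hQd', hQ'⟩ := (det_weightedHankel_eq_zero_iff _ w s).1 hz'
  have e1 := key z Q hQ0 hQd hQ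
  have e2 := key z' Q' hQ0' hQd' hQ'
  have hne : w * Q * Q' ≠ 0 := mul_ne_zero (mul_ne_zero hw0 hQ0) hQ0'
  have hd : (w * Q * Q').natDegree = n + 1 := by
    rw [natDegree_mul (mul_ne_zero hw0 hQ0) hQ0', natDegree_mul hw0 hQ0]
    omega
  -- Each kernel polynomial is tested against the other, so both relations concern `w * Q * Q'` and
  -- differ only in the last coordinate.
  have h1 := hQ Q' hQd'
  have h2 := hQ' Q hQd
  rw [show w * Q' * Q = w * Q * Q' by ring] at h2
  rw [momentFunctional_snoc x _ hd.le] at h1 h2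
  have hc : (w * Q * Q').coeff (n + 1) ≠ 0 := by
    rw [← hd]
    exact leadingCoeff_ne_zero.2 hne
  exact mul_left_cancel₀ hc (by linarith)

/-- A weighted Hankel determinant vanishes if the functional annihilates the multiples of `w * Q`
for some nonzero `Q` of small degree. -/
lemma det_weightedHankel_eq_zero_of_prod {d s : ℕ} {v : Fin d → ℝ} {w : ℝ[X]}
    (hs : w.natDegree + 2 * s ≤ d) (y : Fin s → ℝ)
    (h : ∀ p : ℝ[X], p.natDegree ≤ d → (∀ t, w.eval t = 0 → p.eval t = 0) →
      (∀ j, p.eval (y j) = 0) → momentFunctional v p = 0) :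
    (weightedHankel v w s).det = 0 := by
  have hm : (∏ j, (X - C (y j))).Monic := monic_prod_X_sub_C y Finset.univ
  have hdeg : (∏ j, (X - C (y j))).natDegree = s := by simp
  refine (det_weightedHankel_eq_zero_iff v w s).2 ⟨∏ j, (X - C (y j)), hm.ne_zero, hdeg.le,
    fun R hR => h _ ?_ (fun t ht => by simp [ht]) fun j => ?_⟩
  · have h1 := natDegree_mul_le (p := w * ∏ j, (X - C (y j))) (q := R)
    have h2 := natDegree_mul_le (p := w) (q := ∏ j, (X - C (y j)))
    omega
  · have : (∏ i, (X - C (y i))).eval (y j) = 0 := by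
      rw [eval_prod]
      exact Finset.prod_eq_zero (Finset.mem_univ j) (by simp)
    simp [this]

lemma weightedHankel_X {d : ℕ} (v : Fin d → ℝ) (s : ℕ) :
    weightedHankel v X s = Matrix.of fun i j => moment v (i.val + j.val + 1) := by
  ext i j
  simp only [weightedHankel, Matrix.of_apply]
  rw [← pow_succ', momentFunctional_X_pow]

lemma weightedHankel_one {d : ℕ} (v : Fin d → ℝ) (s : ℕ) :
    weightedHankel v 1 s = Matrix.of fun i j => moment v (i.val + j.val) := by
  ext i j
  simp only [weightedHankel, Matrix.of_apply, one_mul, momentFunctional_X_pow]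

lemma weightedHankel_one_sub_X {d : ℕ} (v : Fin d → ℝ) (s : ℕ) :
    weightedHankel v (1 - X) s =
      Matrix.of fun i j => moment v (i.val + j.val) - moment v (i.val + j.val + 1) := by
  ext i j
  simp only [weightedHankel, Matrix.of_apply]
  rw [sub_mul, one_mul, ← pow_succ', map_sub, momentFunctional_X_pow, momentFunctional_X_pow]

lemma weightedHankel_X_mul_one_sub_X {d : ℕ} (v : Fin d → ℝ) (s : ℕ) :
    weightedHankel v (X * (1 - X)) s =
      Matrix.of fun i j => moment v (i.val + j.val + 1) - moment v (i.val + j.val + 2) := by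
  ext i j
  simp only [weightedHankel, Matrix.of_apply]
  rw [show (X * (1 - X) * X ^ (i.val + j.val) : ℝ[X]) =
      X ^ (i.val + j.val + 1) - X ^ (i.val + j.val + 2) by ring, map_sub,
    momentFunctional_X_pow, momentFunctional_X_pow]

lemma natDegree_one_sub_X : (1 - X : ℝ[X]).natDegree = 1 := by
  rw [← neg_sub, natDegree_neg]
  exact natDegree_X_sub_C 1

lemma one_sub_X_ne_zero : (1 - X : ℝ[X]) ≠ 0 :=
  ne_zero_of_natDegree_gt (n := 0) (by rw [natDegree_one_sub_X]; norm_num)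

lemma natDegree_X_mul_one_sub_X : (X * (1 - X) : ℝ[X]).natDegree = 2 := by
  rw [natDegree_mul X_ne_zero one_sub_X_ne_zero, natDegree_one_sub_X, natDegree_X]

/-! ### Vanishing of the determinants on the surfaces -/

/-- All atoms lie at the `y_j` or at the root `1` of the weight. Since the masses sum to `1`, the
constant coefficient of `p` cancels and only values of `p` at atoms remain. The three lemmas below
follow the same pattern. -/
lemma det_eq_zero_of_mem_UEven {ℓ : ℕ} (q : (Fin ℓ → ℝ) × (Fin ℓ → ℝ)) :
    (weightedHankel (UEven (momentCurve (2 * ℓ + 1)) 1 ℓ q) (1 - X) ℓ).det = 0 := by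
  refine det_weightedHankel_eq_zero_of_prod (by rw [natDegree_one_sub_X]; omega) q.2
    fun p hp hw hy => ?_
  have h1 := hw 1 (by simp)
  rw [momentFunctional_eq_coeffForm _ hp, UEven]
  simp only [map_add, map_sum, map_smul, coeffForm_momentCurve _ hp, hy, h1, smul_eq_mul,
    ← Finset.sum_mul]
  ring

lemma det_eq_zero_of_mem_LEven {ℓ : ℕ} (q : (Fin ℓ → ℝ) × (Fin ℓ → ℝ)) :
    (weightedHankel (LEven (momentCurve (2 * ℓ + 1)) 0 ℓ q) X ℓ).det = 0 := by
  refine det_weightedHankel_eq_zero_of_prod (by rw [natDegree_X]; omega) q.2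
    fun p hp hw hy => ?_
  have h0 := hw 0 (by simp)
  rw [momentFunctional_eq_coeffForm _ hp, LEven]
  simp only [map_add, map_sum, map_smul, coeffForm_momentCurve _ hp, hy, h0, smul_eq_mul,
    ← Finset.sum_mul]
  ring

lemma det_eq_zero_of_mem_UOdd {m : ℕ} (q : (Fin (m + 1) → ℝ) × (Fin m → ℝ)) :
    (weightedHankel (UOdd (momentCurve (2 * m + 1 + 1)) 0 1 m q) (X * (1 - X)) m).det = 0 := by
  refine det_weightedHankel_eq_zero_of_prod (by rw [natDegree_X_mul_one_sub_X]; omega) q.2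
    fun p hp hw hy => ?_
  have h0 := hw 0 (by simp)
  have h1 := hw 1 (by simp)
  rw [momentFunctional_eq_coeffForm _ hp, UOdd]
  simp only [map_add, map_sum, map_smul, coeffForm_momentCurve _ hp, hy, h0, h1, smul_eq_mul,
    ← Finset.sum_mul, Fin.sum_univ_succ]
  ring

lemma det_eq_zero_of_mem_LOdd {m : ℕ} (q : (Fin m → ℝ) × (Fin (m + 1) → ℝ)) :
    (weightedHankel (LOdd (momentCurve (2 * m + 1 + 1)) m q) 1 (m + 1)).det = 0 := by
  refine det_weightedHankel_eq_zero_of_prod (by rw [natDegree_one]; omega) q.2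
    fun p hp hw hy => ?_
  rw [momentFunctional_eq_coeffForm _ hp, LOdd]
  simp only [map_add, map_sum, map_smul, coeffForm_momentCurve _ hp, hy, smul_eq_mul,
    ← Finset.sum_mul]
  ring

/-! ### Convex geometry of the moment space and supporting polynomials -/

/-- In a finite-dimensional space the convex hull of a compact set is compact. -/
lemma isCompact_convexHull_of_isCompact {E : Type*} [NormedAddCommGroup E] [NormedSpace ℝ E]
    [FiniteDimensional ℝ E] {s : Set E} (hs : IsCompact s) : IsCompact (convexHull ℝ s) := by
  rcases s.eq_empty_or_nonempty with rfl | ⟨e, he⟩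
  · simp
  set N := Module.finrank ℝ E + 1
  -- Carathéodory: at most `N` points suffice, and shorter families are padded with the point `e` at
  -- weight zero.
  have himg : convexHull ℝ s = (fun q : (Fin N → ℝ) × (Fin N → E) => ∑ i, q.1 i • q.2 i) ''
      (stdSimplex ℝ (Fin N) ×ˢ Set.pi univ fun _ => s) := by
    apply Subset.antisymm
    · intro v hv
      obtain ⟨ι, _, z, w, hz, hind, hw, hsum, rfl⟩ := eq_pos_convex_span_of_mem_convexHull hv
      have hcard : Fintype.card ι ≤ Fintype.card (Fin N) := by
        rw [Fintype.card_fin]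
        exact hind.card_le_finrank_succ.trans (by
          simpa [N] using Submodule.finrank_le (vectorSpan ℝ (range z)))
      obtain ⟨g⟩ := Function.Embedding.nonempty_of_card_le hcard
      have hg := g.injective
      have hzero : ∀ i ∉ range g, Function.extend g w 0 i = 0 := fun i hi => by
        rw [Function.extend_apply' _ _ _ (by simpa using hi)]; rfl
      refine ⟨(Function.extend g w 0, Function.extend g z fun _ => e), ⟨⟨fun i => ?_, ?_⟩,
        fun i _ => ?_⟩, ?_⟩
      · by_cases hi : i ∈ range g
        · obtain ⟨a, rfl⟩ := hi
          simpa [hg.extend_apply] using (hw a).le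
        · exact (hzero i hi).ge
      · rw [← hsum]
        refine (Fintype.sum_of_injective g hg _ _ hzero fun a => ?_).symm
        rw [hg.extend_apply]
      · by_cases hi : i ∈ range g
        · obtain ⟨a, rfl⟩ := hi
          simpa [hg.extend_apply] using hz (mem_range_self a)
        · simpa [Function.extend_apply' _ _ _ (show ¬∃ a, g a = i by simpa using hi)] using he
      · refine (Fintype.sum_of_injective g hg _ _ (fun i hi => ?_) fun a => ?_).symm
        · simp [hzero i hi]
        · simp [hg.extend_apply]
    · rintro _ ⟨q, ⟨⟨hq0, hq1⟩, hq2⟩, rfl⟩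
      exact (convex_convexHull ℝ s).sum_mem (fun i _ => hq0 i) hq1
        fun i _ => subset_convexHull ℝ s (hq2 i (mem_univ i))
  rw [himg]
  refine ((isCompact_stdSimplex ℝ (Fin N)).prod (isCompact_univ_pi fun _ => hs)).image ?_
  fun_prop

lemma continuous_momentCurve (d : ℕ) : Continuous (momentCurve d) := by
  unfold momentCurve
  fun_prop

/-- Every affine function of the moment point comes from a polynomial. -/
lemma exists_polynomial_momentFunctional_eq {d : ℕ} (c : ℝ) (φ : (Fin d → ℝ) →ₗ[ℝ] ℝ) :
    ∃ p : ℝ[X], p.natDegree ≤ d ∧ (∀ i : Fin d, p.coeff (i + 1) = φ (Pi.single i 1)) ∧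
      ∀ v, momentFunctional v p = c + φ v := by
  set p : ℝ[X] := C c + ∑ i : Fin d, C (φ (Pi.single i 1)) * X ^ (i.val + 1) with hp
  have hdeg : p.natDegree ≤ d := by
    refine natDegree_add_le_of_degree_le (by simp) (natDegree_sum_le_of_forall_le _ _ fun i _ => ?_)
    exact (natDegree_C_mul_X_pow_le _ _).trans (by omega)
  have h0 : p.coeff 0 = c := by simp [hp, coeff_X_pow]
  have h1 : ∀ i : Fin d, p.coeff (i + 1) = φ (Pi.single i 1) := fun i => by
    simp [hp, coeff_X_pow, Fin.val_inj]
  refine ⟨p, hdeg, h1, fun v => ?_⟩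
  rw [momentFunctional_apply v hdeg, h0]
  congr 1
  conv_rhs => rw [LinearMap.pi_apply_eq_sum_univ φ v]
  refine Finset.sum_congr rfl fun i _ => ?_
  rw [h1, smul_eq_mul, mul_comm]
  congr 2
  ext j
  simp [Pi.single_apply, eq_comm]

lemma momentFunctional_momentCurve {d : ℕ} (t : ℝ) {p : ℝ[X]} (hp : p.natDegree ≤ d) :
    momentFunctional (momentCurve d t) p = p.eval t := by
  rw [momentFunctional_eq_coeffForm _ hp, coeffForm_momentCurve _ hp]
  ring

/-- A linear form vanishing on the curve is a polynomial with infinitely many roots, hence zero. As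
the curve passes through `0`, its affine span is its linear span. -/
lemma interior_convexHull_momentCurve_nonempty (d : ℕ) :
    (interior (convexHull ℝ (momentCurve d '' Icc 0 1))).Nonempty := by
  rw [interior_convexHull_nonempty_iff_affineSpan_eq_top]
  have hzero : (0 : Fin d → ℝ) ∈ momentCurve d '' Icc 0 1 :=
    ⟨0, by simp, by ext i; simp [momentCurve]⟩
  have hspan : Submodule.span ℝ (momentCurve d '' Icc 0 1) = ⊤ := by
    by_contra hne
    obtain ⟨φ, hφ0, hφ⟩ := Submodule.exists_le_ker_of_lt_top _ (lt_top_iff_ne_top.2 hne)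
    obtain ⟨p, hdeg, -, hp⟩ := exists_polynomial_momentFunctional_eq 0 φ
    have hroot : p = 0 := by
      refine eq_zero_of_infinite_isRoot p ((Icc_infinite one_pos).mono fun t ht => ?_)
      rw [mem_ofPred_eq, IsRoot, ← momentFunctional_momentCurve t hdeg, hp, zero_add]
      exact hφ (Submodule.subset_span ⟨t, ht, rfl⟩)
    exact hφ0 (LinearMap.ext fun v => by simpa [hroot] using (hp v).symm)
  apply SetLike.coe_injective
  rw [← insert_eq_of_mem hzero, affineSpan_insert_zero, hspan]
  rfl

/-- Above an interior point `x` of the moment space there is a point of the next moment space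
(the one where `σ * z` is largest) at which some polynomial, nonnegative on `[0, 1]` and with
leading coefficient of sign `-σ`, has moment zero. -/
lemma exists_supporting_polynomial {n : ℕ} {x : Fin n → ℝ}
    (hx : x ∈ interior (convexHull ℝ (momentCurve n '' Icc 0 1))) {σ : ℝ} (hσ : σ ≠ 0) :
    ∃ (z : ℝ) (p : ℝ[X]),
      (Fin.snoc x z : Fin (n + 1) → ℝ) ∈ convexHull ℝ (momentCurve (n + 1) '' Icc 0 1) ∧
      p.natDegree ≤ n + 1 ∧ (∀ t ∈ Icc (0 : ℝ) 1, 0 ≤ p.eval t) ∧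
      momentFunctional (Fin.snoc x z : Fin (n + 1) → ℝ) p = 0 ∧
      σ * p.coeff (n + 1) < 0 := by
  set H := convexHull ℝ (momentCurve (n + 1) '' Icc 0 1) with hH
  have hHc : IsCompact H := isCompact_convexHull_of_isCompact
    (isCompact_Icc.image (continuous_momentCurve _))
  have hHconv : Convex ℝ H := convex_convexHull ℝ _
  let π : (Fin (n + 1) → ℝ) →ₗ[ℝ] (Fin n → ℝ) := LinearMap.funLeft ℝ ℝ Fin.castSucc
  have hπ : π '' H = convexHull ℝ (momentCurve n '' Icc 0 1) := by
    rw [hH, π.image_convexHull, image_image]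
    rfl
  have hfib : IsCompact (H ∩ {v | π v = x}) :=
    hHc.inter_right (isClosed_eq π.continuous_of_finiteDimensional continuous_const)
  have hne : (H ∩ {v | π v = x}).Nonempty := by
    have := interior_subset hx
    rw [← hπ] at this
    obtain ⟨v, hv, hvx⟩ := this
    exact ⟨v, hv, hvx⟩
  obtain ⟨v, ⟨hvH, hvx⟩, hmax⟩ := hfib.exists_isMaxOn hne
    (f := fun v => σ * v (Fin.last n)) (by fun_prop)
  have hv : v = Fin.snoc x (v (Fin.last n)) := by
    conv_lhs => rw [← Fin.snoc_init_self v]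
    rw [← hvx]
    rfl
  set e : Fin (n + 1) → ℝ := Pi.single (Fin.last n) 1 with he
  have hπe : π e = 0 := by
    ext i
    simp [π, e, LinearMap.funLeft_apply, (Fin.castSucc_lt_last i).ne]
  -- the hull together with everything below it, with respect to `σ`
  set D : Set (Fin (n + 1) → ℝ) := {u | ∃ s : ℝ, 0 ≤ s ∧ u + (σ * s) • e ∈ H} with hD
  have hHD : H ⊆ D := fun u hu => ⟨0, le_rfl, by simpa using hu⟩
  have hDconv : Convex ℝ D := by
    rintro u ⟨s, hs, hu⟩ u' ⟨s', hs', hu'⟩ a b ha hb hab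
    refine ⟨a * s + b * s', by positivity, ?_⟩
    convert hHconv hu hu' ha hb hab using 1
    module
  have hDint : (interior D).Nonempty :=
    (interior_convexHull_momentCurve_nonempty (n + 1)).mono (interior_mono hHD)
  -- Otherwise a point of `D` lies strictly beyond `v` in direction `σ • e`. Lifting it into `H`
  -- stays over `x` and contradicts maximality.
  have hvD : v ∉ interior D := by
    intro hvD
    have hcont : ContinuousAt (fun r : ℝ => v + (σ * r) • e) 0 := by fun_prop
    have hnhds := hcont.preimage_mem_nhds (t := D) (by simpa using mem_interior_iff_mem_nhds.1 hvD)
    obtain ⟨ε, hε, hball⟩ := Metric.mem_nhds_iff.1 hnhds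
    obtain ⟨s, hs, hmem⟩ := hball (show ε / 2 ∈ Metric.ball 0 ε by
      rw [Metric.mem_ball, Real.dist_eq, sub_zero, abs_of_pos (by positivity)]; linarith)
    have h1 := hmax (a := v + (σ * (ε / 2)) • e + (σ * s) • e)
      ⟨hmem, by simp [hπe, show π v = x from hvx]⟩
    simp only [Pi.add_apply, Pi.smul_apply, he, Pi.single_eq_same, smul_eq_mul,
      mem_ofPred_eq] at h1
    have h2 : 0 < σ * σ * (ε / 2 + s) := by
      have := mul_self_pos.2 hσ
      positivity
    nlinarith
  obtain ⟨f, hf⟩ := geometric_hahn_banach_open_point hDconv.interior isOpen_interior hvD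
  have hfD : ∀ u ∈ D, f u ≤ f v := by
    intro u hu
    have hcl : closure (interior D) ⊆ {u | f u ≤ f v} :=
      closure_minimal (fun u hu => (hf u hu).le) (isClosed_le f.continuous continuous_const)
    refine hcl ?_
    rw [hDconv.closure_interior_eq_closure_of_nonempty_interior hDint]
    exact subset_closure hu
  obtain ⟨p, hdeg, hcoeff, hp⟩ :=
    exists_polynomial_momentFunctional_eq (f v) (-(f : (Fin (n + 1) → ℝ) →ₗ[ℝ] ℝ))
  simp only [LinearMap.neg_apply, ContinuousLinearMap.coe_coe] at hcoeff hp
  have hnn : ∀ t ∈ Icc (0 : ℝ) 1, 0 ≤ p.eval t := by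
    intro t ht
    have := hfD _ (hHD (subset_convexHull ℝ _ ⟨t, ht, rfl⟩))
    rw [← momentFunctional_momentCurve t hdeg, hp]
    linarith
  have hpv : momentFunctional v p = 0 := by
    rw [hp]
    ring
  have hp0 : p ≠ 0 := by
    rintro rfl
    obtain ⟨u, hu⟩ := hDint
    have h1 := hp u
    have h2 := hf u hu
    rw [map_zero] at h1
    linarith
  have hlast : p.coeff (n + 1) = -f e := hcoeff (Fin.last n)
  rw [hv] at hpv hvH
  refine ⟨v (Fin.last n), p, hvH, hdeg, hnn, hpv, lt_of_le_of_ne ?_ ?_⟩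
  -- `D` contains the ray from `v` in direction `-σ • e`, which fixes the weak sign of the leading
  -- coefficient.
  · have h1 := hfD (v - σ • e) ⟨1, zero_le_one, by rw [← hv] at hvH; simpa using hvH⟩
    rw [map_sub, map_smul, smul_eq_mul] at h1
    rw [hlast]
    linarith
  -- A zero coefficient would mean a vertical hyperplane: `p` would have degree at most `n` and a
  -- positive moment at `x`.
  · refine mul_ne_zero hσ fun h0 => ?_
    have hdeg' : p.natDegree ≤ n := by
      refine natDegree_le_iff_coeff_eq_zero.2 fun N hN => ?_
      rcases Nat.eq_or_lt_of_le (Nat.succ_le_of_lt hN) with rfl | hN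
      · exact h0
      · exact coeff_eq_zero_of_natDegree_lt (hdeg.trans_lt hN)
    rw [momentFunctional_snoc_of_natDegree_le _ _ hdeg'] at hpv
    exact (momentFunctional_pos_of_mem_interior hdeg' hnn hp0 hx).ne' hpv

/-! ### Atomic representations and counting of nodes -/

/-- A point of the moment space at which `p ≥ 0` has moment zero is represented by a measure on
the roots of `p` in `[0, 1]`. -/
lemma exists_weights_on_roots {d : ℕ} {v : Fin d → ℝ}
    (hv : v ∈ convexHull ℝ (momentCurve d '' Icc 0 1)) {p : ℝ[X]} (hdeg : p.natDegree ≤ d)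
    (hnn : ∀ t ∈ Icc (0 : ℝ) 1, 0 ≤ p.eval t) (hv0 : momentFunctional v p = 0)
    {Z : Finset ℝ} (hZ : ∀ t ∈ Icc (0 : ℝ) 1, p.eval t = 0 → t ∈ Z) :
    ∃ c : ℝ → ℝ, (∀ t, 0 ≤ c t) ∧ (∀ t ∉ Z, c t = 0) ∧ ∑ t ∈ Z, c t = 1 ∧
      ∑ t ∈ Z, c t • momentCurve d t = v := by
  rw [convexHull_eq] at hv
  obtain ⟨ι, S, w, g, hw, hsum, hg, hcm⟩ := hv
  rw [Finset.centerMass_eq_of_sum_1 _ _ hsum] at hcm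
  have hτ : ∀ i, ∃ t, i ∈ S → t ∈ Icc (0 : ℝ) 1 ∧ momentCurve d t = g i := fun i => by
    by_cases hi : i ∈ S
    · obtain ⟨t, ht⟩ := hg i hi
      exact ⟨t, fun _ => ht⟩
    · exact ⟨0, fun h => absurd h hi⟩
  choose τ hτ using hτ
  have hcm' : v = ∑ i ∈ S, w i • momentCurve d (τ i) := by
    rw [← hcm]
    exact Finset.sum_congr rfl fun i hi => by rw [(hτ i hi).2]
  have hterm : ∀ i ∈ S, w i * p.eval (τ i) = 0 := by
    rw [hcm', momentFunctional_sum S w τ hsum hdeg] at hv0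
    exact (Finset.sum_eq_zero_iff_of_nonneg fun i hi =>
      mul_nonneg (hw i hi) (hnn _ (hτ i hi).1)).1 hv0
  have hmem : ∀ i ∈ S.filter (fun i => w i ≠ 0), τ i ∈ Z := by
    intro i hi
    rw [Finset.mem_filter] at hi
    exact hZ _ (hτ i hi.1).1 ((mul_eq_zero.1 (hterm i hi.1)).resolve_left hi.2)
  -- The mass at `t` collects all indices with parameter `t`. Zero weights are dropped first because
  -- their parameters need not be roots.
  refine ⟨fun t => ∑ i ∈ (S.filter fun i => w i ≠ 0).filter fun i => τ i = t, w i,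
    fun t => ?_, fun t ht => ?_, ?_, ?_⟩
  · refine Finset.sum_nonneg fun i hi => hw i ?_
    simp only [Finset.mem_filter] at hi
    exact hi.1.1
  · refine Finset.sum_eq_zero fun i hi => ?_
    rw [Finset.mem_filter] at hi
    exact absurd (hi.2 ▸ hmem i hi.1) ht
  · rw [Finset.sum_fiberwise_of_maps_to hmem, Finset.sum_filter_ne_zero, hsum]
  · have hfib : ∀ t ∈ Z,
        (∑ i ∈ (S.filter fun i => w i ≠ 0).filter fun i => τ i = t, w i) • momentCurve d t =
        ∑ i ∈ (S.filter fun i => w i ≠ 0).filter fun i => τ i = t,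
          w i • momentCurve d (τ i) := by
      intro t _
      rw [Finset.sum_smul]
      refine Finset.sum_congr rfl fun i hi => ?_
      rw [(Finset.mem_filter.1 hi).2]
    rw [Finset.sum_congr rfl hfib, Finset.sum_fiberwise_of_maps_to hmem, hcm']
    refine Finset.sum_filter_of_ne fun i _ hne h0 => hne ?_
    rw [h0, zero_smul]

/-- Roots in `(0, 1)` of a polynomial that is nonnegative on `[0, 1]` count twice. If the count
exhausts the degree, the sign of the leading coefficient is determined by whether `1` is a
root. -/
lemma card_roots_of_nonneg {N : ℕ} {p : ℝ[X]} (hdeg : p.natDegree = N) (hp0 : p ≠ 0)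
    (hnn : ∀ t ∈ Icc (0 : ℝ) 1, 0 ≤ p.eval t) {Z : Finset ℝ}
    (hZ : ∀ t ∈ Z, t ∈ Icc (0 : ℝ) 1 ∧ p.eval t = 0) :
    ∃ k, k + (if (0 : ℝ) ∈ Z then 1 else 0) + (if (1 : ℝ) ∈ Z then 1 else 0) = 2 * Z.card ∧
      k ≤ N ∧ (k = N → 0 < (if (1 : ℝ) ∈ Z then -1 else 1) * p.coeff N) := by
  set m : ℝ → ℕ := fun y => if y = 0 ∨ y = 1 then 1 else 2 with hm
  have hdvd : ∏ y ∈ Z, (X - C y) ^ m y ∣ p := by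
    refine Finset.prod_dvd_of_coprime (fun a _ b _ hab => ?_) fun y hy => ?_
    · exact (pairwise_coprime_X_sub_C Function.injective_id hab).pow
    · obtain ⟨hyI, hy0⟩ := hZ y hy
      rw [← le_rootMultiplicity_iff hp0]
      simp only [hm]
      split_ifs with h
      · exact (rootMultiplicity_pos hp0).2 hy0
      · push Not at h
        refine (one_lt_rootMultiplicity_iff_isRoot hp0).2 ⟨hy0, ?_⟩
        have hnhds : Icc (0 : ℝ) 1 ∈ nhds y :=
          Icc_mem_nhds (lt_of_le_of_ne hyI.1 (Ne.symm h.1)) (lt_of_le_of_ne hyI.2 h.2)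
        -- An interior zero of a nonnegative function is a minimum, so the derivative vanishes and
        -- the root is at least double.
        have hloc : IsLocalMin (fun t => p.eval t) y := by
          filter_upwards [hnhds] with t ht
          rw [hy0]
          exact hnn t ht
        exact hloc.hasDerivAt_eq_zero (p.hasDerivAt y)
  obtain ⟨r, hr⟩ := hdvd
  have hmonic : (∏ y ∈ Z, (X - C y) ^ m y).Monic :=
    monic_prod_of_monic _ _ fun y _ => (monic_X_sub_C y).pow _
  have hqdeg : (∏ y ∈ Z, (X - C y) ^ m y).natDegree = ∑ y ∈ Z, m y := by
    rw [natDegree_prod_of_monic _ _ fun y _ => (monic_X_sub_C y).pow _]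
    simp
  have hr0 : r ≠ 0 := by
    rintro rfl
    exact hp0 (by rw [hr, mul_zero])
  have hpdeg : p.natDegree = ∑ y ∈ Z, m y + r.natDegree := by
    rw [hr, hmonic.natDegree_mul' hr0, hqdeg]
  refine ⟨∑ y ∈ Z, m y, ?_, by omega, fun hk => ?_⟩
  · have hpt : ∀ y : ℝ, m y + (if y = 0 then 1 else 0) + (if y = 1 then 1 else 0) = 2 := by
      intro y
      simp only [hm]
      by_cases h0 : y = 0
      · simp [h0]
      · by_cases h1 : y = 1 <;> simp [h0, h1]
    have := Finset.sum_congr (rfl : Z = Z) fun y _ => hpt y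
    rw [Finset.sum_add_distrib, Finset.sum_add_distrib, Finset.sum_ite_eq', Finset.sum_ite_eq',
      Finset.sum_const, smul_eq_mul] at this
    omega
  · have hrC : r = C (p.coeff N) := by
      have h1 : r.natDegree = 0 := by omega
      have h2 : p.leadingCoeff = r.leadingCoeff := by
        rw [hr, leadingCoeff_mul, hmonic.leadingCoeff, one_mul]
      rw [← hdeg, coeff_natDegree, h2, leadingCoeff, h1]
      exact eq_C_of_natDegree_eq_zero h1
    -- At a non-root `t` in `(0, 1)` the only negative factor is `t - 1`, present exactly when `1 ∈
    -- Z`. Then `p.eval t ≥ 0` decides the sign of the leading coefficient.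
    obtain ⟨t, ht, htZ⟩ := (Ioo_infinite (zero_lt_one (α := ℝ))).exists_notMem_finset Z
    have hpos : 0 < (if (1 : ℝ) ∈ Z then -1 else 1) * ∏ y ∈ Z, (t - y) ^ m y := by
      have : (if (1 : ℝ) ∈ Z then (-1 : ℝ) else 1) = ∏ y ∈ Z, if y = 1 then -1 else 1 := by
        rw [Finset.prod_ite_eq']
      rw [this, ← Finset.prod_mul_distrib]
      refine Finset.prod_pos fun y hy => ?_
      have hne : t - y ≠ 0 := sub_ne_zero.2 fun h => htZ (h ▸ hy)
      simp only [hm]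
      by_cases h0 : y = 0
      · simpa [h0] using ht.1
      · by_cases h1 : y = 1
        · simpa [h1] using ht.2
        · simp only [h0, h1, or_self, if_false, one_mul]
          positivity
    have hev : p.eval t = (∏ y ∈ Z, (t - y) ^ m y) * p.coeff N := by
      conv_lhs => rw [hr, hrC]
      simp [eval_prod]
    have h1 := hnn t ⟨ht.1.le, ht.2.le⟩
    have hc : p.coeff N ≠ 0 := by
      rw [← hdeg, coeff_natDegree]
      exact leadingCoeff_ne_zero.2 hp0
    rw [hev] at h1
    set A := ∏ y ∈ Z, (t - y) ^ m y
    split_ifs at hpos ⊢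
    · have : A < 0 := by linarith
      have := nonpos_of_mul_nonneg_right h1 this
      have := lt_of_le_of_ne this hc
      linarith
    · rw [one_mul] at hpos ⊢
      exact lt_of_le_of_ne (nonneg_of_mul_nonneg_right h1 hpos) hc.symm

/-- Above an interior point of the moment space there is a point with an atomic representation
of minimal index; `σ > 0` gives the upper and `σ < 0` the lower one. -/
lemma exists_principal_representation {n : ℕ} {x : Fin n → ℝ}
    (hx : x ∈ interior (convexHull ℝ (momentCurve n '' Icc 0 1))) {σ : ℝ} (hσ : σ ≠ 0) :
    ∃ (z : ℝ) (c : ℝ → ℝ) (Z : Finset ℝ) (k : ℕ), (∀ t ∈ Z, t ∈ Icc (0 : ℝ) 1) ∧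
      (∀ t, 0 ≤ c t) ∧ (∀ t ∉ Z, c t = 0) ∧ ∑ t ∈ Z, c t = 1 ∧
      ∑ t ∈ Z, c t • momentCurve (n + 1) t = Fin.snoc x z ∧
      k + (if (0 : ℝ) ∈ Z then 1 else 0) + (if (1 : ℝ) ∈ Z then 1 else 0) = 2 * Z.card ∧
      k ≤ n + 1 ∧ (k = n + 1 → (1 ∈ Z ↔ 0 < σ)) := by
  obtain ⟨z, p, hmem, hdeg, hnn, hp, hlead⟩ := exists_supporting_polynomial hx hσ
  have hc : p.coeff (n + 1) ≠ 0 := right_ne_zero_of_mul hlead.ne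
  have hp0 : p ≠ 0 := by
    rintro rfl
    simp at hc
  have hdeg' : p.natDegree = n + 1 := hdeg.antisymm (le_natDegree_of_ne_zero hc)
  set Z : Finset ℝ := p.roots.toFinset.filter (· ∈ Icc (0 : ℝ) 1) with hZdef
  have hZ : ∀ t, t ∈ Z ↔ t ∈ Icc (0 : ℝ) 1 ∧ p.eval t = 0 := fun t => by
    rw [hZdef, Finset.mem_filter, Multiset.mem_toFinset, mem_roots hp0, IsRoot, and_comm]
  obtain ⟨c, hc0, hcZ, hc1, hcv⟩ :=
    exists_weights_on_roots hmem hdeg hnn hp fun t ht h0 => (hZ t).2 ⟨ht, h0⟩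
  obtain ⟨k, hk, hkn, hsign⟩ := card_roots_of_nonneg hdeg' hp0 hnn fun t ht => (hZ t).1 ht
  refine ⟨z, c, Z, k, fun t ht => ((hZ t).1 ht).1, hc0, hcZ, hc1, hcv, hk, hkn, fun h => ?_⟩
  have h1 := hsign h
  split_ifs at h1 with hmem1
  · refine iff_of_true hmem1 (pos_of_mul_neg_left hlead ?_)
    linarith
  · refine iff_of_false hmem1 fun hpos => ?_
    nlinarith

/-- The surfaces ask for exactly `k` nodes, so missing ones are filled with arbitrary further points
of `J`; they will carry zero weight. -/
lemma exists_strictMono_nodes {J : Set ℝ} (hJ : J.Infinite) {B : Finset ℝ} (hB : ↑B ⊆ J) {k : ℕ}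
    (hk : B.card ≤ k) :
    ∃ y : Fin k → ℝ, StrictMono y ∧ (∀ j, y j ∈ J) ∧ B ⊆ Finset.univ.image y := by
  obtain ⟨T, hT, hTc⟩ := (hJ.sdiff B.finite_toSet).exists_subset_card_eq (k - B.card)
  have hdisj : Disjoint B T := Finset.disjoint_right.2 fun t ht => by simpa using (hT ht).2
  have hcard : (B ∪ T).card = k := by
    rw [Finset.card_union_of_disjoint hdisj, hTc]
    omega
  have hrange : Finset.univ.image ((B ∪ T).orderEmbOfFin hcard) = B ∪ T := by
    rw [← Finset.coe_inj]
    simp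
  refine ⟨(B ∪ T).orderEmbOfFin hcard, (Finset.orderEmbOfFin _ hcard).strictMono, fun j => ?_, ?_⟩
  · rcases Finset.mem_union.1 (Finset.orderEmbOfFin_mem _ hcard j) with h | h
    · exact hB h
    · exact (hT h).1
  · rw [hrange]
    exact Finset.subset_union_left

/-- A sum over a set of nodes, rewritten with an enumeration of all nodes outside a set `E`. -/
lemma sum_eq_sum_nodes {M : Type*} [AddCommMonoid M] {Z E : Finset ℝ} {k : ℕ} {y : Fin k → ℝ}
    (hy : Function.Injective y) (hyE : ∀ j, y j ∉ E) (hZ : Z \ E ⊆ Finset.univ.image y)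
    (g : ℝ → M) (hg : ∀ t ∉ Z, g t = 0) : ∑ t ∈ Z, g t = ∑ t ∈ E, g t + ∑ j, g (y j) := by
  have hdisj : Disjoint E (Finset.univ.image y) := by
    refine Finset.disjoint_right.2 fun t ht => ?_
    obtain ⟨j, -, rfl⟩ := Finset.mem_image.1 ht
    exact hyE j
  rw [← Finset.sum_image (f := g) (fun i _ j _ h => hy h), ← Finset.sum_union hdisj]
  refine Finset.sum_subset (fun t ht => ?_) fun t _ ht => hg t ht
  by_cases hE : t ∈ E
  · exact Finset.mem_union_left _ hE
  · exact Finset.mem_union_right _ (hZ (Finset.mem_sdiff.2 ⟨ht, hE⟩))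

/-- Above an interior point of the moment space there is a point represented by the end points
in `E` together with `k` further ordered nodes, provided `E` and `k` fit the dimension. -/
lemma exists_ordered_representation {n : ℕ} {x : Fin n → ℝ}
    (hx : x ∈ interior (convexHull ℝ (momentCurve n '' Icc 0 1))) {σ : ℝ} (hσ : σ ≠ 0)
    {E : Finset ℝ} {k : ℕ} (hE : E ⊆ {0, 1}) (hk : E.card + 2 * k = n + 1)
    (hσE : 1 ∈ E ↔ 0 < σ) :
    ∃ (z : ℝ) (c : ℝ → ℝ) (y : Fin k → ℝ), y ∈ nodeSimplex 0 1 k ∧ (∀ t, 0 ≤ c t) ∧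
      ∑ t ∈ E, c t + ∑ j, c (y j) = 1 ∧
      ∑ t ∈ E, c t • momentCurve (n + 1) t + ∑ j, c (y j) • momentCurve (n + 1) (y j) =
        Fin.snoc x z := by
  obtain ⟨z, c, Z, N, hZI, hc0, hcZ, hc1, hcv, hN, hNn, hsign⟩ :=
    exists_principal_representation hx hσ
  -- Twice this cardinality is `N` plus, for each end point in `Z`, `1` if it is outside `E` and
  -- `-1` if inside. For `N ≤ n` this is at most `2 * k + 1`. For `N = n + 1` the same bound holds
  -- because `1 ∈ Z ↔ 1 ∈ E`. Parity then gives `k`.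
  have hcard : (Z \ E).card ≤ k := by
    have h1 := Finset.card_sdiff_add_card_inter Z E
    have hEi : ∀ S : Finset ℝ, S ⊆ {0, 1} →
        S.card = (if (0 : ℝ) ∈ S then 1 else 0) + (if (1 : ℝ) ∈ S then 1 else 0) := by
      intro S hS
      rw [← Finset.sum_pair (f := fun t : ℝ => if t ∈ S then 1 else 0) zero_ne_one,
        Finset.sum_ite_mem, Finset.inter_eq_right.2 hS, Finset.card_eq_sum_ones]
    have h2 := hEi E hE
    have h3 := hEi (Z ∩ E) (Finset.inter_subset_right.trans hE)
    simp only [Finset.mem_inter] at h3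
    by_cases hN' : N = n + 1
    · have h4 := hsign hN'
      rw [← hσE] at h4
      by_cases a : (0 : ℝ) ∈ Z <;> by_cases b : (1 : ℝ) ∈ Z <;> by_cases a' : (0 : ℝ) ∈ E <;>
        by_cases b' : (1 : ℝ) ∈ E <;>
        simp only [a, b, a', b', if_true, if_false, and_true, and_false, and_self,
          iff_true, iff_false, not_true] at hN h2 h3 h4 <;> omega
    · split_ifs at hN h2 h3 <;> first | omega | (exfalso; tauto)
  -- Nodes are chosen outside `E` so that no end point mass is counted twice.
  have hJ : (Icc (0 : ℝ) 1 \ ↑E).Infinite := (Icc_infinite one_pos).sdiff E.finite_toSet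
  obtain ⟨y, hy, hyJ, hyB⟩ := exists_strictMono_nodes hJ (B := Z \ E)
    (fun t ht => by
      rw [Finset.mem_coe, Finset.mem_sdiff] at ht
      exact ⟨hZI t ht.1, ht.2⟩) hcard
  have hyE : ∀ j, y j ∉ E := fun j => (hyJ j).2
  refine ⟨z, c, y, ⟨fun j => (hyJ j).1, hy.monotone⟩, hc0, ?_, ?_⟩
  · rw [← hc1, sum_eq_sum_nodes hy.injective hyE hyB c hcZ]
  · rw [← hcv, sum_eq_sum_nodes hy.injective hyE hyB (fun t => c t • momentCurve (n + 1) t)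
      fun t ht => by rw [hcZ t ht, zero_smul]]

/-! ### Points on the surfaces and identification with the determinants -/

/-- If `P` has a solution, implies `Q`, and `Q` has at most one solution, then both are
equivalent to being the chosen solution of `P`. -/
lemma epsilon_iff_of_unique {P Q : ℝ → Prop} (hPQ : ∀ z, P z → Q z)
    (huniq : ∀ z z', Q z → Q z' → z = z') (hex : ∃ z, P z) :
    (∀ z, P z ↔ z = Classical.epsilon P) ∧ ∀ z, Q z ↔ z = Classical.epsilon P := by
  have hε := Classical.epsilon_spec hex
  refine ⟨fun z => ⟨fun h => huniq _ _ (hPQ _ h) (hPQ _ hε), ?_⟩,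
    fun z => ⟨fun h => huniq _ _ h (hPQ _ hε), ?_⟩⟩
  · rintro rfl
    exact hε
  · rintro rfl
    exact hPQ _ hε

section Surfaces

variable {n : ℕ} {x : Fin n → ℝ}

lemma exists_mem_upperSurface (hx : x ∈ interior (convexHull ℝ (momentCurve n '' Icc 0 1))) :
    ∃ z : ℝ, (Fin.snoc x z : Fin (n + 1) → ℝ) ∈ upperSurface (momentCurve (n + 1)) 0 1 := by
  rcases Nat.even_or_odd n with hn | hn
  · have hmod := Nat.even_iff.1 hn
    obtain ⟨z, c, y, hy, hc, hsum, hrep⟩ := exists_ordered_representation hx one_ne_zero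
      (E := {1}) (k := n / 2) (by simp) (by simp; omega) (by simp)
    rw [Finset.sum_singleton] at hsum hrep
    refine ⟨z, ?_⟩
    rw [upperSurface, if_pos hn, ← hrep]
    refine ⟨(fun j => c (y j), y), ⟨⟨fun j => hc _, ?_⟩, hy⟩, ?_⟩
    · linarith [hc 1]
    · have hw : 1 - ∑ j, c (y j) = c 1 := by linarith
      simp only [UEven, hw]
      exact add_comm _ _
  · have hmod := Nat.odd_iff.1 hn
    obtain ⟨z, c, y, hy, hc, hsum, hrep⟩ := exists_ordered_representation hx one_ne_zero
      (E := {0, 1}) (k := n / 2) subset_rfl (by rw [Finset.card_pair zero_ne_one]; omega) (by simp)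
    rw [Finset.sum_pair zero_ne_one] at hsum hrep
    refine ⟨z, ?_⟩
    rw [upperSurface, if_neg (Nat.not_even_iff_odd.2 hn), ← hrep]
    -- In `UOdd` the first weight belongs to the end point `1`, and the complementary mass is that
    -- of `0`.
    have hs : ∑ j, (Fin.cons (c 1) (fun j => c (y j)) : Fin (n / 2 + 1) → ℝ) j = 1 - c 0 := by
      rw [Fin.sum_cons]
      linarith
    refine ⟨(Fin.cons (c 1) fun j => c (y j), y), ⟨⟨fun j => ?_, ?_⟩, hy⟩, ?_⟩
    · refine Fin.cases ?_ (fun j => ?_) j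
      · exact hc 1
      · exact hc _
    · rw [hs]
      linarith [hc 0]
    · simp only [UOdd, hs, Fin.cons_zero, Fin.cons_succ]
      rw [sub_sub_cancel]
      abel

lemma exists_mem_lowerSurface (hx : x ∈ interior (convexHull ℝ (momentCurve n '' Icc 0 1))) :
    ∃ z : ℝ, (Fin.snoc x z : Fin (n + 1) → ℝ) ∈ lowerSurface (momentCurve (n + 1)) 0 1 := by
  have hσ : (-1 : ℝ) ≠ 0 := by norm_num
  rcases Nat.even_or_odd n with hn | hn
  · have hmod := Nat.even_iff.1 hn
    obtain ⟨z, c, y, hy, hc, hsum, hrep⟩ := exists_ordered_representation hx hσ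
      (E := {0}) (k := n / 2) (by simp) (by simp; omega) (by norm_num)
    rw [Finset.sum_singleton] at hsum hrep
    refine ⟨z, ?_⟩
    rw [lowerSurface, if_pos hn, ← hrep]
    refine ⟨(fun j => c (y j), y), ⟨⟨fun j => hc _, ?_⟩, hy⟩, ?_⟩
    · linarith [hc 0]
    · rw [LEven, ← hsum, add_sub_cancel_right]
  · have hmod := Nat.odd_iff.1 hn
    obtain ⟨z, c, y, hy, hc, hsum, hrep⟩ := exists_ordered_representation hx hσ
      (E := ∅) (k := n / 2 + 1) (by simp) (by simp; omega) (by norm_num)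
    rw [Finset.sum_empty, zero_add, Fin.sum_univ_succ] at hsum hrep
    refine ⟨z, ?_⟩
    rw [lowerSurface, if_neg (Nat.not_even_iff_odd.2 hn), ← hrep]
    -- The smallest node carries the complementary mass, so only the weights of its successors are
    -- listed.
    refine ⟨(fun j => c (y j.succ), y), ⟨⟨fun j => hc _, ?_⟩, hy⟩, ?_⟩
    · linarith [hc (y 0)]
    · rw [LOdd, ← hsum, add_sub_cancel_right]

end Surfaces

lemma hankelK_two_mul_add_one (ℓ : ℕ) (v : Fin (2 * ℓ + 1) → ℝ) :
    hankelK (2 * ℓ + 1) v = (weightedHankel v (1 - X) ℓ).det := by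
  rw [hankelK, if_neg (by simp), weightedHankel_one_sub_X,
    show (2 * ℓ + 1) / 2 = ℓ by omega]

lemma hankelK_two_mul_add_two (m : ℕ) (v : Fin (2 * m + 1 + 1) → ℝ) :
    hankelK (2 * m + 1 + 1) v = (weightedHankel v (X * (1 - X)) m).det := by
  rw [hankelK, if_pos ⟨m + 1, by omega⟩, weightedHankel_X_mul_one_sub_X,
    show (2 * m + 1 + 1) / 2 = m + 1 by omega]

lemma hankelS_two_mul_add_one (ℓ : ℕ) (v : Fin (2 * ℓ + 1) → ℝ) :
    hankelS (2 * ℓ + 1) v = (weightedHankel v X ℓ).det := by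
  rw [hankelS, if_neg (by simp), weightedHankel_X, show (2 * ℓ + 1) / 2 = ℓ by omega]

lemma hankelS_two_mul_add_two (m : ℕ) (v : Fin (2 * m + 1 + 1) → ℝ) :
    hankelS (2 * m + 1 + 1) v = (weightedHankel v 1 (m + 1)).det := by
  rw [hankelS, if_pos ⟨m + 1, by omega⟩, weightedHankel_one,
    show (2 * m + 1 + 1) / 2 = m + 1 by omega]

section Surfaces

variable {n : ℕ} {x : Fin n → ℝ}

lemma hankelK_eq_zero_of_mem_upperSurface {v : Fin (n + 1) → ℝ}
    (hv : v ∈ upperSurface (momentCurve (n + 1)) 0 1) : hankelK (n + 1) v = 0 := by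
  rcases Nat.even_or_odd' n with ⟨ℓ, rfl | rfl⟩
  · rw [upperSurface, if_pos (even_two_mul ℓ), show 2 * ℓ / 2 = ℓ by omega] at hv
    obtain ⟨q, -, rfl⟩ := hv
    rw [hankelK_two_mul_add_one]
    exact det_eq_zero_of_mem_UEven q
  · rw [upperSurface, if_neg (by simp), show (2 * ℓ + 1) / 2 = ℓ by omega] at hv
    obtain ⟨q, -, rfl⟩ := hv
    rw [hankelK_two_mul_add_two]
    exact det_eq_zero_of_mem_UOdd q

lemma hankelS_eq_zero_of_mem_lowerSurface {v : Fin (n + 1) → ℝ}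
    (hv : v ∈ lowerSurface (momentCurve (n + 1)) 0 1) : hankelS (n + 1) v = 0 := by
  rcases Nat.even_or_odd' n with ⟨ℓ, rfl | rfl⟩
  · rw [lowerSurface, if_pos (even_two_mul ℓ), show 2 * ℓ / 2 = ℓ by omega] at hv
    obtain ⟨q, -, rfl⟩ := hv
    rw [hankelS_two_mul_add_one]
    exact det_eq_zero_of_mem_LEven q
  · rw [lowerSurface, if_neg (by simp), show (2 * ℓ + 1) / 2 = ℓ by omega] at hv
    obtain ⟨q, -, rfl⟩ := hv
    rw [hankelS_two_mul_add_two]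
    exact det_eq_zero_of_mem_LOdd q

lemma eq_of_hankelK_eq_zero (hx : x ∈ interior (convexHull ℝ (momentCurve n '' Icc 0 1)))
    {z z' : ℝ} (hz : hankelK (n + 1) (Fin.snoc x z : Fin (n + 1) → ℝ) = 0)
    (hz' : hankelK (n + 1) (Fin.snoc x z' : Fin (n + 1) → ℝ) = 0) : z = z' := by
  rcases Nat.even_or_odd' n with ⟨ℓ, rfl | rfl⟩
  · rw [hankelK_two_mul_add_one] at hz hz'
    refine eq_of_det_weightedHankel_eq_zero one_sub_X_ne_zero (fun t ht => ?_)
      (by rw [natDegree_one_sub_X]; omega) hx hz hz'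
    simpa using ht.2
  · rw [hankelK_two_mul_add_two] at hz hz'
    refine eq_of_det_weightedHankel_eq_zero (mul_ne_zero X_ne_zero one_sub_X_ne_zero)
      (fun t ht => ?_) (by rw [natDegree_X_mul_one_sub_X]; omega) hx hz hz'
    simpa using mul_nonneg ht.1 (sub_nonneg.2 ht.2)

lemma eq_of_hankelS_eq_zero (hx : x ∈ interior (convexHull ℝ (momentCurve n '' Icc 0 1)))
    {z z' : ℝ} (hz : hankelS (n + 1) (Fin.snoc x z : Fin (n + 1) → ℝ) = 0)
    (hz' : hankelS (n + 1) (Fin.snoc x z' : Fin (n + 1) → ℝ) = 0) : z = z' := by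
  rcases Nat.even_or_odd' n with ⟨ℓ, rfl | rfl⟩
  · rw [hankelS_two_mul_add_one] at hz hz'
    refine eq_of_det_weightedHankel_eq_zero X_ne_zero (fun t ht => ?_)
      (by rw [natDegree_X]; omega) hx hz hz'
    simpa using ht.1
  · rw [hankelS_two_mul_add_two] at hz hz'
    refine eq_of_det_weightedHankel_eq_zero one_ne_zero (fun t ht => ?_)
      (by rw [natDegree_one]; omega) hx hz hz'
    simp

end Surfaces

end CurveHull

theorem corollary2p4 (n : ℕ) (hn : 1 ≤ n) (x : Fin n → ℝ)
    (hx : x ∈ interior (convexHull ℝ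
      (CurveHull.projCurve (CurveHull.momentCurve (n + 1)) '' Set.Icc (0 : ℝ) 1))) :
    -- `B^sup` and `B^inf` are well defined at `x`
    (∀ z : ℝ, (Fin.snoc x z : Fin (n + 1) → ℝ) ∈
        CurveHull.upperSurface (CurveHull.momentCurve (n + 1)) 0 1 ↔
      z = CurveHull.Bsup (CurveHull.momentCurve (n + 1)) 0 1 x) ∧
    (∀ z : ℝ, (Fin.snoc x z : Fin (n + 1) → ℝ) ∈
        CurveHull.lowerSurface (CurveHull.momentCurve (n + 1)) 0 1 ↔
      z = CurveHull.Binf (CurveHull.momentCurve (n + 1)) 0 1 x) ∧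
    -- and they are the unique solutions `x_{n+1}` of `K_{n+1} = 0` and `S_{n+1} = 0`
    (∀ z : ℝ, CurveHull.hankelK (n + 1) (Fin.snoc x z : Fin (n + 1) → ℝ) = 0 ↔
      z = CurveHull.Bsup (CurveHull.momentCurve (n + 1)) 0 1 x) ∧
    (∀ z : ℝ, CurveHull.hankelS (n + 1) (Fin.snoc x z : Fin (n + 1) → ℝ) = 0 ↔
      z = CurveHull.Binf (CurveHull.momentCurve (n + 1)) 0 1 x) := by
  -- Here `P` is membership in the surface and `Q` the vanishing of the determinant. The hypothesis
  -- `hx` fits since the projected curve is `momentCurve n` by definition.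
  obtain ⟨hU, hK⟩ := CurveHull.epsilon_iff_of_unique
    (fun z => CurveHull.hankelK_eq_zero_of_mem_upperSurface (v := Fin.snoc x z))
    (fun z z' => CurveHull.eq_of_hankelK_eq_zero hx) (CurveHull.exists_mem_upperSurface hx)
  obtain ⟨hL, hS⟩ := CurveHull.epsilon_iff_of_unique
    (fun z => CurveHull.hankelS_eq_zero_of_mem_lowerSurface (v := Fin.snoc x z))
    (fun z z' => CurveHull.eq_of_hankelS_eq_zero hx) (CurveHull.exists_mem_lowerSurface hx)
  exact ⟨hU, hL, hK, hS⟩
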